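/- Setting. There are $n$ items and one unit-demand buyer whose values $v_1,\dots,v_n\ge 0$ are independent; $v_i$ has density $f_i$, distribution function $F_i$ and finite mean. Let $\phi_i(v)=v-\frac{1-F_i(v)}{f_i(v)}$ be Myerson's virtual value. Assume that each distribution is regular: $\{f_i>0\}$ is an interval on which $\phi_i$ is strictly increasing (this covers monotone hazard rate distributions). The intermediary faces a real cost $\kappa_i$ if item $i$ is sold (in the intermediation problem $\kappa_i$ is the virtual cost of seller $i$ at its reported cost; $\kappa=0$ is the pure pricing problem). In the $k$-limited attention model the intermediary shows a set $S$ of at most $k$ items at prices $(p_i)_{i\in S}$, and the buyer buys the item of $S$ with the largest $v_i-p_i$ if that is nonnegative, and nothing otherwise. The revenue is $\mathrm{Rev}_\kappa(S,p)=\sum_{i\in S}(p_i-\kappa_i)\Pr[\text{the buyer buys } i]$. Let $Z_S=\max\bigl(0,\max_{i\in S}(\phi_i(v_i)-\kappa_i)\bigr)$, where $0$ stands for no sale, and $g_\kappa(S)=\mathbb E[Z_S]$. The greedy algorithm has access to estimates $\hat g(S)$ of $g_\kappa(S)$. It starts from the empty set and $k$ times (or until all items are chosen) adds to the current set $S$ the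 item $i\notin S$ that maximizes $\hat g(S\cup\{i\})$, taking the first such item in case of ties. Given the resulting set $S$, the anonymous virtual reserve prices are $p_i=\phi_i^{-1}(r+\kappa_i)$, where $r$ is a median of $Z_S$ and $\phi_i^{-1}$ is the generalized inverse: $\phi_i^{-1}(s)$ is the least price with virtual value at least $s$, where $\phi_i(v)=v$ if $F_i(v)=1$. Theorem. (1) Suppose that $|\hat g(S)-g_\kappa(S)|\le\varepsilon$ for all $S$ with $|S|\le k$. Then the greedy algorithm uses at most $kn$ estimates and selects a set $S$ of $\min(k,n)$ items; $Z_S$ has a median; and for every median $r$ of $Z_S$, with the prices $p$ above, $$\mathrm{Rev}_\kappa(S,p)\;\ge\;\frac{e-1}{2e}\,\mathrm{Rev}_\kappa(T,q)-k\varepsilon$$ for every set $T$ of at most $k$ items and all prices $q$. In particular, with exact values of $g_\kappa$ ($\varepsilon=0$) this is an $\frac{e-1}{2e}$-approximation to the optimal revenue in the $k$-limited attention model. (2) The greedy selection with exact values is monotone for the sellers: if item $i$ is selected for the costs $\kappa$, then it is also selected after $\kappa_i$ alone is decreased. -/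

import Mathlib

open MeasureTheory Set

noncomputable section

/-- A distribution of the buyer's value for one item: nonnegative, given by a density, with finite
mean. -/
structure ValueDist where
  pdf : ℝ → ℝ
  measurable_pdf : Measurable pdf
  pdf_nonneg : ∀ v, 0 ≤ pdf v
  lintegral_pdf : ∫⁻ v, ENNReal.ofReal (pdf v) = 1
  pdf_of_neg : ∀ v, v < 0 → pdf v = 0
  integrable_mean : Integrable (fun v => v * pdf v)

namespace ValueDist

/-- The probability measure on `ℝ` with density `pdf`. -/
def law (D : ValueDist) : Measure ℝ := volume.withDensity fun v => ENNReal.ofReal (D.pdf v)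

/-- The cumulative distribution function `F(v)`. -/
def cdf (D : ValueDist) (v : ℝ) : ℝ := D.law.real (Iic v)

/-- Myerson's virtual value `φ(v) = v - (1 - F(v)) / f(v)`. It is only used where `0 < f(v)`, or
where `F(v) = 1`, in which case it equals `v`. -/
def virtualValue (D : ValueDist) (v : ℝ) : ℝ := v - (1 - D.cdf v) / D.pdf v

/-- The density is positive on an interval, and the virtual value is strictly increasing there, so
that it can be inverted. Distributions with a monotone hazard rate have this property. -/
def IsRegular (D : ValueDist) : Prop :=
  {v | 0 < D.pdf v}.OrdConnected ∧ StrictMonoOn D.virtualValue {v | 0 < D.pdf v}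

/-- The price `φ⁻¹(s)`. It is the generalized inverse, because `φ` may have jumps: the least price
whose virtual value is at least `s`. If `s` lies below all the virtual values, this is the lower end
of the support; if `s` lies above all of them, it is a price at which the item is not sold. -/
def virtualInverse (D : ValueDist) (s : ℝ) : ℝ :=
  sInf {p | (0 < D.pdf p ∨ D.cdf p = 1) ∧ s ≤ D.virtualValue p}

end ValueDist

/-- The joint law of the buyer's independent values. -/
def valueLaw {n : ℕ} (D : Fin n → ValueDist) : Measure (Fin n → ℝ) :=
  Measure.pi fun i => (D i).law

/-- The event that a unit-demand buyer who looks at the items in `S`, offered at the prices `p`,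
buys item `i`: the surplus `v i - p i` is nonnegative and is the largest one in `S`. Ties have
probability zero, because the values are independent and have densities. -/
def buysItem {n : ℕ} (S : Finset (Fin n)) (p : Fin n → ℝ) (i : Fin n) : Set (Fin n → ℝ) :=
  {v | i ∈ S ∧ 0 ≤ v i - p i ∧ ∀ j ∈ S, v j - p j ≤ v i - p i}

/-- The intermediary's expected revenue, net of the cost `κ i` that it faces when item `i` is sold,
from showing the items in `S` at the prices `p`. -/
def revenue {n : ℕ} (D : Fin n → ValueDist) (κ : Fin n → ℝ) (S : Finset (Fin n))
    (p : Fin n → ℝ) : ℝ :=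
  ∑ i ∈ S, (p i - κ i) * (valueLaw D).real (buysItem S p i)

/-- The largest virtual value, net of costs, of an item in `S`; it is `0` (no sale) if all of them
are negative. -/
def maxVirtual {n : ℕ} (D : Fin n → ValueDist) (κ : Fin n → ℝ) (S : Finset (Fin n))
    (v : Fin n → ℝ) : ℝ :=
  S.fold max 0 fun i => (D i).virtualValue (v i) - κ i

/-- The expectation of the largest virtual value of an item in `S`. -/
def expMaxVirtual {n : ℕ} (D : Fin n → ValueDist) (κ : Fin n → ℝ) (S : Finset (Fin n)) : ℝ :=
  ∫ v, maxVirtual D κ S v ∂(valueLaw D)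

/-- `r` is a median of the random variable `Z` under the probability measure `P`. -/
def IsMedian {Ω : Type*} [MeasurableSpace Ω] (P : Measure Ω) (Z : Ω → ℝ) (r : ℝ) : Prop :=
  1 / 2 ≤ P {ω | Z ω ≤ r} ∧ 1 / 2 ≤ P {ω | r ≤ Z ω}

/-- The anonymous virtual reserve prices for the virtual reserve `r`: the value for item `i`, net of
the cost `κ i`, has the virtual value `φᵢ(v) - κ i`, and the price makes it equal to `r`. -/
def virtualReservePrices {n : ℕ} (D : Fin n → ValueDist) (κ : Fin n → ℝ) (r : ℝ) :
    Fin n → ℝ :=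
  fun i => (D i).virtualInverse (r + κ i)

/-- Programs that may query an oracle `Q → ℝ`. -/
inductive OracleProg (Q α : Type) : Type
  | done (a : α) : OracleProg Q α
  | ask (q : Q) (next : ℝ → OracleProg Q α) : OracleProg Q α

namespace OracleProg

def bind {Q α β : Type} : OracleProg Q α → (α → OracleProg Q β) → OracleProg Q β
  | done a, g => g a
  | ask q next, g => ask q fun x => bind (next x) g

/-- The result of a program with the oracle `o`. -/
def run {Q α : Type} (o : Q → ℝ) : OracleProg Q α → α
  | done a => a
  | ask q next => run o (next (o q))

/-- The number of oracle queries of a program with the oracle `o`. -/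
def queries {Q α : Type} (o : Q → ℝ) : OracleProg Q α → ℕ
  | done _ => 0
  | ask q next => queries o (next (o q)) + 1

end OracleProg

/-- Goes through a list of items and finds the first item `i` outside `S` for which the oracle's
answer to `insert i S` is largest; `best` is the best item so far, with the answer for it. -/
def scanItems {n : ℕ} (S : Finset (Fin n)) :
    List (Fin n) → Option (Fin n × ℝ) → OracleProg (Finset (Fin n)) (Option (Fin n × ℝ))
  | [], best => .done best
  | i :: l, best =>
    if i ∈ S then scanItems S l best
    else .ask (insert i S) fun x =>
      match best with
      | none => scanItems S l (some (i, x))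
      | some (j, y) => if y < x then scanItems S l (some (i, x)) else scanItems S l (some (j, y))

/-- Greedily adds up to `k` items to `S`. -/
def greedyFrom {n : ℕ} : ℕ → Finset (Fin n) → OracleProg (Finset (Fin n)) (Finset (Fin n))
  | 0, S => .done S
  | k + 1, S =>
    (scanItems S (List.finRange n) none).bind fun best =>
      match best with
      | none => .done S
      | some (i, _) => greedyFrom k (insert i S)

/-- The greedy algorithm that selects the `k` items to show (all items if there are fewer). -/
def greedy (n k : ℕ) : OracleProg (Finset (Fin n)) (Finset (Fin n)) := greedyFrom k ∅

end

/-!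
Fixing the values of the other items, item `i` is sold exactly when `v i` reaches a threshold `t`
that is at least its price, and integration by parts shows that a price `t` raises at most the
expected virtual value on `t ≤ v i`, with equality if the density is positive from `t` to the end of
the support, as it is for the price `t = φ⁻¹(s)` of a regular distribution. Since at most one item
is sold, any revenue from a set `T` is at most the expectation of `Z_T`.

The function `S ↦ E[Z_S]` is monotone and submodular, being an average of maxima. So each greedy
round shrinks the gap to `E[Z_T]` by the factor `1 - 1/k`, up to `2ε` for the errors of the two
estimates compared, and after `k` rounds a factor `(1 - 1/k)^k ≤ 1/e` of the gap is left.

Posting a median `r` of `Z_S` as a common virtual reserve loses another factor `2`, as in the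
prophet inequality: with probability at least `1/2` some item is sold, which pays for `r`, and with
probability at least `1/2` all the competitors of an item are priced out, so that the item earns at
least half of its expected excess over `r`.

Lowering `κ i` only raises the values of the sets that contain `i`. Hence the greedy selection
proceeds as before until it picks `i`, which happens no later than for the old cost.
-/

section RealMeasure

theorem max_sub_zero_eq_indicator {α : Type*} (f : α → ℝ) (s : ℝ) :
    (fun a => max (f a - s) 0) = {a | s ≤ f a}.indicator fun a => f a - s := by
  ext a
  by_cases ha : s ≤ f a
  · rw [indicator_of_mem (show a ∈ {a | s ≤ f a} from ha), max_eq_left (sub_nonneg.2 ha)]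
  · rw [indicator_of_notMem (show a ∉ {a | s ≤ f a} from ha),
      max_eq_right (sub_nonpos.2 (not_le.1 ha).le)]

variable {μ : Measure ℝ} {t : ℝ}

theorem measurable_measure_Ioi (μ : Measure ℝ) : Measurable fun v => μ (Ioi v) :=
  Antitone.measurable fun _ _ h => measure_mono (Ioi_subset_Ioi h)

theorem setLIntegral_measure_Ioi (μ : Measure ℝ) (t : ℝ) :
    ∫⁻ v in Ioi t, μ (Ioi v) = ∫⁻ v, ENNReal.ofReal (max (v - t) 0) ∂μ := by
  have hshift := (measurePreserving_add_right volume t).setLIntegral_comp_preimage_emb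
    (measurableEmbedding_addRight t) (fun v => μ (Ioi v)) (Ioi t)
  rw [preimage_add_const_Ioi, sub_self] at hshift
  rw [lintegral_eq_lintegral_meas_lt (f := fun v => max (v - t) 0) μ
    (.of_forall fun _ => le_max_right _ _) (by fun_prop), ← hshift]
  refine setLIntegral_congr_fun measurableSet_Ioi fun u (hu : 0 < u) => congrArg μ ?_
  ext v
  simp [hu.not_gt, lt_sub_iff_add_lt]

theorem integrable_max_sub_zero (h : IntegrableOn (fun v => v - t) (Ici t) μ) :
    Integrable (fun v => max (v - t) 0) μ := by
  rw [max_sub_zero_eq_indicator fun v : ℝ => v]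
  exact h.integrable_indicator measurableSet_Ici

theorem setLIntegral_measure_Ioi_ne_top (h : IntegrableOn (fun v => v - t) (Ici t) μ) :
    ∫⁻ v in Ioi t, μ (Ioi v) ≠ ⊤ := by
  rw [setLIntegral_measure_Ioi]
  exact (integrable_max_sub_zero h).lintegral_lt_top.ne

theorem integrableOn_measureReal_Ioi (h : IntegrableOn (fun v => v - t) (Ici t) μ) :
    IntegrableOn (fun v => μ.real (Ioi v)) (Ioi t) :=
  integrable_toReal_of_lintegral_ne_top (measurable_measure_Ioi μ).aemeasurable
    (setLIntegral_measure_Ioi_ne_top h)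

theorem setIntegral_measureReal_Ioi (h : IntegrableOn (fun v => v - t) (Ici t) μ) :
    ∫ v in Ioi t, μ.real (Ioi v) = ∫ v in Ici t, (v - t) ∂μ :=
  calc ∫ v in Ioi t, μ.real (Ioi v)
    _ = (∫⁻ v in Ioi t, μ (Ioi v)).toReal :=
      integral_toReal (measurable_measure_Ioi μ).aemeasurable
        (ae_lt_top (measurable_measure_Ioi μ) (setLIntegral_measure_Ioi_ne_top h))
    _ = ∫ v, max (v - t) 0 ∂μ := by
      rw [setLIntegral_measure_Ioi, integral_eq_lintegral_of_nonneg_ae (f := fun v => max (v - t) 0)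
        (.of_forall fun _ => le_max_right _ _) (integrable_max_sub_zero h).aestronglyMeasurable]
    _ = ∫ v in Ici t, (v - t) ∂μ := by
      rw [max_sub_zero_eq_indicator fun v : ℝ => v]
      exact integral_indicator measurableSet_Ici

theorem exists_le_cdf_and_leftLim_cdf_le (μ : Measure ℝ) {q : ℝ} (hq0 : 0 < q) (hq1 : q < 1) :
    ∃ r, q ≤ ProbabilityTheory.cdf μ r ∧ Function.leftLim (ProbabilityTheory.cdf μ) r ≤ q := by
  have hmono := ProbabilityTheory.monotone_cdf μ
  have hne : {x | q ≤ ProbabilityTheory.cdf μ x}.Nonempty :=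
    ((ProbabilityTheory.tendsto_cdf_atTop μ).eventually_const_le hq1).exists
  have hbdd : BddBelow {x | q ≤ ProbabilityTheory.cdf μ x} := by
    obtain ⟨b, hb⟩ := ((ProbabilityTheory.tendsto_cdf_atBot μ).eventually_lt_const hq0).exists
    exact ⟨b, fun x hx => le_of_not_gt fun hxb => (hb.trans_le hx).not_ge (hmono hxb.le)⟩
  refine ⟨sInf {x | q ≤ ProbabilityTheory.cdf μ x}, ?_, ?_⟩
  · have hright := ((ProbabilityTheory.cdf μ).right_continuous
      (sInf {x | q ≤ ProbabilityTheory.cdf μ x})).mono_left (nhdsWithin_mono _ Ioi_subset_Ici_self)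
    refine ge_of_tendsto hright ?_
    filter_upwards [self_mem_nhdsWithin] with x hx
    obtain ⟨a, ha, hax⟩ := exists_lt_of_csInf_lt hne hx
    exact le_trans ha (hmono hax.le)
  · refine le_of_tendsto (hmono.tendsto_leftLim _) ?_
    filter_upwards [self_mem_nhdsWithin] with x hx
    exact le_of_not_gt fun hqx => notMem_of_lt_csInf hx hbdd hqx.le

theorem exists_isMedian {Ω : Type*} [MeasurableSpace Ω] (P : Measure Ω) [IsProbabilityMeasure P]
    {Z : Ω → ℝ} (hZ : AEMeasurable Z P) : ∃ r, IsMedian P Z r := by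
  have := Measure.isProbabilityMeasure_map hZ
  obtain ⟨r, hle, hge⟩ :=
    exists_le_cdf_and_leftLim_cdf_le (P.map Z) (q := 1 / 2) (by norm_num) (by norm_num)
  have hhalf : ENNReal.ofReal (1 / 2) = 1 / 2 := by simp
  refine ⟨r, ?_, ?_⟩
  · calc 1 / 2 ≤ ENNReal.ofReal (ProbabilityTheory.cdf (P.map Z) r) :=
        hhalf.symm.trans_le (ENNReal.ofReal_le_ofReal hle)
      _ = P.map Z (Iic r) := ProbabilityTheory.ofReal_cdf _ _
      _ = P {ω | Z ω ≤ r} := Measure.map_apply_of_aemeasurable hZ measurableSet_Iic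
  · calc 1 / 2 ≤ ENNReal.ofReal (1 - Function.leftLim (ProbabilityTheory.cdf (P.map Z)) r) :=
        hhalf.symm.trans_le (ENNReal.ofReal_le_ofReal (by linarith))
      _ = (ProbabilityTheory.cdf (P.map Z)).measure (Ici r) :=
        (StieltjesFunction.measure_Ici _ (ProbabilityTheory.tendsto_cdf_atTop _) r).symm
      _ = P {ω | r ≤ Z ω} := by
        rw [ProbabilityTheory.measure_cdf]
        exact Measure.map_apply_of_aemeasurable hZ measurableSet_Ici

end RealMeasure

section Pi

variable {ι : Type*} [Fintype ι] [DecidableEq ι] {X : ι → Type*} [∀ i, MeasurableSpace (X i)]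
  (μ : ∀ i, Measure (X i)) [∀ i, SigmaFinite (μ i)] (i : ι) [IsProbabilityMeasure (μ i)]

theorem measurePreserving_pi_update :
    MeasurePreserving (fun a : (∀ j, X j) × X i => Function.update a.1 i a.2)
      ((Measure.pi μ).prod (μ i)) (Measure.pi μ) := by
  refine ⟨measurable_update', (Measure.pi_eq fun s hs => ?_).symm⟩
  have hpre : (fun a : (∀ j, X j) × X i => Function.update a.1 i a.2) ⁻¹' univ.pi s =
      univ.pi (Function.update s i univ) ×ˢ s i := by
    ext a
    simp only [mem_preimage, mem_prod, mem_univ_pi]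
    refine ⟨fun h => ⟨fun j => ?_, by simpa using h i⟩, fun h j => ?_⟩
    · rcases eq_or_ne j i with rfl | hj
      · simp
      · simpa [hj] using h j
    · rcases eq_or_ne j i with rfl | hj
      · simpa using h.2
      · simpa [hj] using h.1 j
  rw [Measure.map_apply measurable_update' (.univ_pi hs), hpre, Measure.prod_prod,
    Measure.pi_pi, ← Finset.mul_prod_erase _ _ (Finset.mem_univ i),
    ← Finset.mul_prod_erase _ (fun j => μ j (s j)) (Finset.mem_univ i),
    Function.update_self, measure_univ, one_mul, mul_comm]
  congr 1
  refine Finset.prod_congr rfl fun j hj => ?_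
  rw [Function.update_of_ne (Finset.ne_of_mem_erase hj)]

theorem integral_pi_eq_integral_integral_update {E : Type*} [NormedAddCommGroup E]
    [NormedSpace ℝ E] {f : (∀ j, X j) → E} (hf : Integrable f (Measure.pi μ)) :
    ∫ v, f v ∂Measure.pi μ = ∫ v, ∫ x, f (Function.update v i x) ∂μ i ∂Measure.pi μ := by
  have hupd := measurePreserving_pi_update μ i
  calc ∫ v, f v ∂Measure.pi μ
    _ = ∫ a, f (Function.update a.1 i a.2) ∂(Measure.pi μ).prod (μ i) := by
      conv_lhs => rw [← hupd.map_eq]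
      exact integral_map hupd.aemeasurable (by rw [hupd.map_eq]; exact hf.aestronglyMeasurable)
    _ = ∫ v, ∫ x, f (Function.update v i x) ∂μ i ∂Measure.pi μ :=
      integral_prod _ (hupd.integrable_comp_of_integrable hf)

theorem measure_pi_eval_preimage_inter {s : Set (X i)} {C : Set (∀ j, X j)} (hs : MeasurableSet s)
    (hC : MeasurableSet C) (hCi : ∀ v x, Function.update v i x ∈ C ↔ v ∈ C) :
    Measure.pi μ (Function.eval i ⁻¹' s ∩ C) = μ i s * Measure.pi μ C := by
  have hpre : (fun a : (∀ j, X j) × X i => Function.update a.1 i a.2) ⁻¹'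
      (Function.eval i ⁻¹' s ∩ C) = C ×ˢ s := by
    ext a
    simp [hCi, and_comm]
  rw [← (measurePreserving_pi_update μ i).measure_preimage
    ((measurable_pi_apply i hs).inter hC).nullMeasurableSet, hpre, Measure.prod_prod, mul_comm]

theorem ae_pi_eval_ne [MeasurableEq (X i)] [NullSingletonClass (μ i)] {f : (∀ j, X j) → X i}
    (hf : Measurable f) (hfi : ∀ v x, f (Function.update v i x) = f v) :
    ∀ᵐ v ∂Measure.pi μ, v i ≠ f v := by
  have hupd := measurePreserving_pi_update μ i
  have hmeas : MeasurableSet {v | v i = f v} := measurableSet_eq_fun (measurable_pi_apply i) hf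
  simp only [ae_iff, ne_eq, not_not]
  rw [← hupd.measure_preimage hmeas.nullMeasurableSet,
    Measure.measure_prod_null (hupd.measurable hmeas)]
  refine .of_forall fun v => measure_mono_null (fun x hx => ?_) (measure_singleton (f v))
  simpa [hfi] using hx

end Pi

section Submodular

/-- Submodular functions on a lattice. The expected largest virtual value is one on the lattice of
sets of items, and this is what the guarantee for the greedy selection rests on. -/
def IsSubmodular {L : Type*} [Lattice L] (g : L → ℝ) : Prop :=
  ∀ a b, g (a ⊔ b) + g (a ⊓ b) ≤ g a + g b

theorem isSubmodular_integral {L Ω : Type*} [Lattice L] [MeasurableSpace Ω] {P : Measure Ω}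
    {F : L → Ω → ℝ} (hF : ∀ a, Integrable (F a) P) (hsub : ∀ ω, IsSubmodular fun a => F a ω) :
    IsSubmodular fun a => ∫ ω, F a ω ∂P := by
  intro a b
  rw [← integral_add (hF _) (hF _), ← integral_add (hF _) (hF _)]
  exact integral_mono ((hF _).add (hF _)) ((hF _).add (hF _)) fun ω => hsub ω a b

variable {ι : Type*}

theorem fold_max_mono {S T : Finset ι} (h : S ⊆ T) (b : ℝ) (f : ι → ℝ) :
    S.fold max b f ≤ T.fold max b f :=
  (Finset.fold_max_le _).2 ⟨(Finset.le_fold_max _).2 (.inl le_rfl),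
    fun i hi => (Finset.le_fold_max _).2 (.inr ⟨i, h hi, le_rfl⟩)⟩

theorem fold_max_le_add_sum {b r : ℝ} (hbr : b ≤ r) (S : Finset ι) (f : ι → ℝ) :
    S.fold max b f ≤ r + ∑ i ∈ S, max (f i - r) 0 := by
  have hnonneg : ∀ i ∈ S, 0 ≤ max (f i - r) 0 := fun _ _ => le_max_right _ _
  refine (Finset.fold_max_le _).2
    ⟨le_add_of_le_of_nonneg hbr (Finset.sum_nonneg hnonneg), fun i hi => ?_⟩
  exact sub_le_iff_le_add'.1 ((le_max_left _ _).trans (Finset.single_le_sum hnonneg hi))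

variable [DecidableEq ι]

theorem fold_max_union (S T : Finset ι) (b : ℝ) (f : ι → ℝ) :
    (S ∪ T).fold max b f = max (S.fold max b f) (T.fold max b f) :=
  eq_of_forall_ge_iff fun c => by
    simp only [Finset.fold_max_le, max_le_iff, Finset.forall_mem_union]
    tauto

theorem isSubmodular_fold_max (b : ℝ) (f : ι → ℝ) :
    IsSubmodular fun S : Finset ι => S.fold max b f := by
  intro S T
  beta_reduce
  rw [Finset.sup_eq_union, Finset.inf_eq_inter, fold_max_union,
    ← max_add_min (S.fold max b f)]
  gcongr
  exact le_min (fold_max_mono Finset.inter_subset_left b f)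
    (fold_max_mono Finset.inter_subset_right b f)

theorem IsSubmodular.sub_le_sum_insert_sub {g : Finset ι → ℝ} (hsub : IsSubmodular g)
    (hmono : Monotone g) (S T : Finset ι) : g T - g S ≤ ∑ i ∈ T, (g (insert i S) - g S) := by
  suffices hunion : g (S ∪ T) - g S ≤ ∑ i ∈ T, (g (insert i S) - g S) from
    (sub_le_sub_right (hmono Finset.subset_union_right) _).trans hunion
  induction T using Finset.induction_on with
  | empty => simp
  | insert i T hi ih =>
    have hstep := hsub (insert i S) (S ∪ T)
    have hinter : g S ≤ g (insert i S ⊓ (S ∪ T)) :=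
      hmono (Finset.subset_inter (Finset.subset_insert i S) Finset.subset_union_left)
    rw [Finset.sup_eq_union, Finset.insert_union, ← Finset.union_assoc, Finset.union_self,
      ← Finset.union_insert] at hstep
    rw [Finset.sum_insert hi]
    linarith

/-- The gains of the at most `K` elements of `T` add up to at least the gap to `g T`, so the best of
them is at least the `K`-th part of it. -/
theorem IsSubmodular.sub_insert_le {g : Finset ι → ℝ} (hsub : IsSubmodular g) (hmono : Monotone g)
    {S T : Finset ι} {K : ℕ} (hK : 0 < K) (hT : T.card ≤ K) {i : ι} {δ : ℝ} (hδ : 0 ≤ δ)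
    (hi : ∀ j ∉ S, g (insert j S) ≤ g (insert i S) + δ) :
    g T - g (insert i S) ≤ (1 - 1 / (K : ℝ)) * (g T - g S) + δ := by
  have hgain : ∀ j ∈ T, g (insert j S) - g S ≤ g (insert i S) - g S + δ := fun j _ => by
    by_cases hj : j ∈ S
    · rw [Finset.insert_eq_of_mem hj]
      linarith [hmono (Finset.subset_insert i S)]
    · linarith [hi j hj]
  have hgap : g T - g S ≤ (g (insert i S) - g S + δ) * K :=
    calc g T - g S ≤ ∑ j ∈ T, (g (insert j S) - g S) := hsub.sub_le_sum_insert_sub hmono S T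
      _ ≤ T.card * (g (insert i S) - g S + δ) :=
        (Finset.sum_le_card_nsmul T _ _ hgain).trans_eq (nsmul_eq_mul _ _)
      _ ≤ (g (insert i S) - g S + δ) * K := by
        rw [mul_comm]
        gcongr
        linarith [hmono (Finset.subset_insert i S)]
  have hpart := (div_le_iff₀ (by positivity)).2 hgap
  linear_combination hpart

end Submodular

namespace ValueDist

variable (D : ValueDist) {s t u v : ℝ}

instance isProbabilityMeasure_law : IsProbabilityMeasure D.law :=
  ⟨by rw [law, withDensity_apply _ MeasurableSet.univ, Measure.restrict_univ, D.lintegral_pdf]⟩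

instance nullSingletonClass_law : NullSingletonClass D.law := by
  unfold law; infer_instance

theorem measurable_ofReal_pdf : Measurable fun v => ENNReal.ofReal (D.pdf v) :=
  D.measurable_pdf.ennreal_ofReal

theorem measurableSet_pdf_pos : MeasurableSet {v | 0 < D.pdf v} :=
  measurableSet_lt measurable_const D.measurable_pdf

theorem law_eq_zero_iff {A : Set ℝ} : D.law A = 0 ↔ volume ({v | 0 < D.pdf v} ∩ A) = 0 := by
  rw [law, withDensity_apply_eq_zero D.measurable_ofReal_pdf]
  simp only [ne_eq, ENNReal.ofReal_eq_zero, not_le]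

theorem ae_pdf_pos : ∀ᵐ v ∂D.law, 0 < D.pdf v := by
  rw [ae_iff, law_eq_zero_iff]
  exact (congrArg volume (inter_compl_self _)).trans measure_empty

theorem law_eq_zero_of_forall_not_pdf_pos {A : Set ℝ} (hA : ∀ v ∈ A, ¬0 < D.pdf v) :
    D.law A = 0 :=
  measure_mono_null hA D.ae_pdf_pos

theorem setIntegral_law (g : ℝ → ℝ) {A : Set ℝ} (hA : MeasurableSet A) :
    ∫ v in A, g v ∂D.law = ∫ v in A, D.pdf v * g v := by
  rw [law, setIntegral_withDensity_eq_setIntegral_toReal_smul D.measurable_ofReal_pdf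
    (.of_forall fun _ => ENNReal.ofReal_lt_top) _ hA]
  simp only [ENNReal.toReal_ofReal (D.pdf_nonneg _), smul_eq_mul]

theorem integrable_law_iff (g : ℝ → ℝ) :
    Integrable g D.law ↔ Integrable fun v => D.pdf v * g v := by
  rw [law, integrable_withDensity_iff_integrable_smul' D.measurable_ofReal_pdf
    (.of_forall fun _ => ENNReal.ofReal_lt_top)]
  simp only [ENNReal.toReal_ofReal (D.pdf_nonneg _), smul_eq_mul]

theorem integrable_id_law : Integrable (fun v => v) D.law := by
  simpa only [integrable_law_iff, mul_comm] using D.integrable_mean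

theorem one_sub_cdf (v : ℝ) : 1 - D.cdf v = D.law.real (Ioi v) := by
  rw [cdf, ← compl_Iic, probReal_compl_eq_one_sub measurableSet_Iic]

theorem cdf_eq_one_iff : D.cdf v = 1 ↔ D.law (Ioi v) = 0 := by
  rw [← measureReal_eq_zero_iff, ← one_sub_cdf, sub_eq_zero, eq_comm]

theorem monotone_cdf : Monotone D.cdf := fun _ _ h => measureReal_mono (Iic_subset_Iic.2 h)

theorem cdf_le_one (v : ℝ) : D.cdf v ≤ 1 := measureReal_le_one

theorem measurable_virtualValue : Measurable D.virtualValue :=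
  measurable_id.sub ((D.monotone_cdf.measurable.const_sub 1).div D.measurable_pdf)

theorem nonneg_of_pdf_pos (h : 0 < D.pdf v) : 0 ≤ v :=
  le_of_not_gt fun hv => h.ne' (D.pdf_of_neg v hv)

theorem virtualValue_of_cdf_eq_one (h : D.cdf v = 1) : D.virtualValue v = v := by
  rw [virtualValue, h, sub_self, zero_div, sub_zero]

theorem virtualValue_le (v : ℝ) : D.virtualValue v ≤ v :=
  sub_le_self _ (div_nonneg (sub_nonneg.2 (D.cdf_le_one v)) (D.pdf_nonneg v))

theorem integrableOn_sub_law (t : ℝ) : IntegrableOn (fun v => v - t) (Ici t) D.law :=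
  (D.integrable_id_law.sub (integrable_const t)).integrableOn

theorem pdf_mul_virtualValue (v : ℝ) : D.pdf v * D.virtualValue v =
    D.pdf v * v - {v | 0 < D.pdf v}.indicator (fun v => D.law.real (Ioi v)) v := by
  rw [virtualValue, one_sub_cdf]
  by_cases h : 0 < D.pdf v
  · rw [indicator_of_mem (show v ∈ {v | 0 < D.pdf v} from h), mul_sub, mul_div_cancel₀ _ h.ne']
  · rw [indicator_of_notMem (show v ∉ {v | 0 < D.pdf v} from h),
      (D.pdf_nonneg v).antisymm' (not_lt.1 h)]
    simp only [zero_mul, sub_zero]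

theorem integrable_virtualValue : Integrable D.virtualValue D.law := by
  simp only [integrable_law_iff, pdf_mul_virtualValue]
  refine ((D.integrable_law_iff _).1 D.integrable_id_law).sub ?_
  rw [integrable_indicator_iff D.measurableSet_pdf_pos]
  exact (integrableOn_measureReal_Ioi (D.integrableOn_sub_law (-1))).mono_set fun v hv =>
    neg_one_lt_zero.trans_le (D.nonneg_of_pdf_pos hv)

theorem setIntegral_virtualValue (t : ℝ) :
    ∫ v in Ici t, D.virtualValue v ∂D.law = t * D.law.real (Ici t) +
      ∫ v in Ioi t, {v | 0 < D.pdf v}ᶜ.indicator (fun v => D.law.real (Ioi v)) v := by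
  have htail := integrableOn_measureReal_Ioi (D.integrableOn_sub_law t)
  have hid := (D.integrable_law_iff _).1 D.integrable_id_law
  have hvirtual : ∫ v in Ici t, D.virtualValue v ∂D.law = ∫ v in Ici t, v ∂D.law -
      ∫ v in Ioi t, {v | 0 < D.pdf v}.indicator (fun v => D.law.real (Ioi v)) v := by
    simp only [D.setIntegral_law _ measurableSet_Ici, pdf_mul_virtualValue,
      integral_Ici_eq_integral_Ioi]
    exact integral_sub hid.integrableOn (htail.indicator D.measurableSet_pdf_pos)
  have hsplit :
      (∫ v in Ioi t, {v | 0 < D.pdf v}.indicator (fun v => D.law.real (Ioi v)) v) +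
        ∫ v in Ioi t, {v | 0 < D.pdf v}ᶜ.indicator (fun v => D.law.real (Ioi v)) v =
      ∫ v in Ioi t, D.law.real (Ioi v) := by
    rw [← integral_add (htail.indicator D.measurableSet_pdf_pos)
      (htail.indicator D.measurableSet_pdf_pos.compl)]
    simp only [indicator_self_add_compl_apply]
  have hconst : ∫ v in Ici t, (v - t) ∂D.law =
      ∫ v in Ici t, v ∂D.law - t * D.law.real (Ici t) := by
    rw [integral_sub D.integrable_id_law.integrableOn (integrable_const t), setIntegral_const,
      smul_eq_mul, mul_comm]
  linear_combination
    hvirtual - hsplit - setIntegral_measureReal_Ioi (D.integrableOn_sub_law t) - hconst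

theorem mul_measureReal_Ici_le (t : ℝ) :
    t * D.law.real (Ici t) ≤ ∫ v in Ici t, D.virtualValue v ∂D.law := by
  rw [setIntegral_virtualValue]
  exact le_add_of_nonneg_right <| integral_nonneg fun v =>
    indicator_nonneg (fun _ _ => measureReal_nonneg) _

/-- The set on which the virtual value is meaningful, either because the density is positive or
because `F = 1` and the virtual value is `v` itself. The generalized inverse of the virtual value
takes its prices there. -/
def virtualDomain : Set ℝ := {v | 0 < D.pdf v ∨ D.cdf v = 1}

variable {D}

theorem setIntegral_virtualValue_of_Ioi_subset (ht : Ioi t ⊆ D.virtualDomain) :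
    ∫ v in Ici t, D.virtualValue v ∂D.law = t * D.law.real (Ici t) := by
  rw [setIntegral_virtualValue, add_eq_left]
  refine setIntegral_eq_zero_of_forall_eq_zero fun v hv => indicator_apply_eq_zero.2 fun hpdf => ?_
  rw [← one_sub_cdf, (ht hv).resolve_left hpdf, sub_self]

theorem nonneg_of_mem_virtualDomain (hv : v ∈ D.virtualDomain) : 0 ≤ v := by
  refine hv.elim D.nonneg_of_pdf_pos fun hcdf => le_of_not_gt fun hneg => ?_
  have hlaw : D.law (Iic v) = 0 := D.law_eq_zero_of_forall_not_pdf_pos fun x hx hpdf =>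
    (D.nonneg_of_pdf_pos hpdf).not_gt (hx.trans_lt hneg)
  simp [cdf, measureReal_def, hlaw] at hcdf

theorem exists_le_pdf_pos (hv : D.cdf v ≠ 0) : ∃ u ≤ v, 0 < D.pdf u := by
  contrapose! hv
  rw [cdf, measureReal_eq_zero_iff]
  exact D.law_eq_zero_of_forall_not_pdf_pos fun u hu => (hv u hu).not_gt

theorem IsRegular.le_of_cdf_eq_one (hD : D.IsRegular) (hu : D.cdf u = 1) (hv : 0 < D.pdf v) :
    v ≤ u := by
  by_contra! huv
  obtain ⟨w, hwu, hw⟩ := exists_le_pdf_pos (hu ▸ one_ne_zero : D.cdf u ≠ 0)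
  have hnull := D.law_eq_zero_iff.1 (D.cdf_eq_one_iff.1 hu)
  have hIoc : Ioc u v ⊆ {v | 0 < D.pdf v} ∩ Ioi u := fun x hx =>
    ⟨hD.1.out hw hv ⟨hwu.trans hx.1.le, hx.2⟩, hx.1⟩
  have hvol := measure_mono_null hIoc hnull
  rw [Real.volume_Ioc, ENNReal.ofReal_eq_zero] at hvol
  linarith

theorem IsRegular.strictMonoOn_virtualValue (hD : D.IsRegular) :
    StrictMonoOn D.virtualValue D.virtualDomain := by
  rintro x hx y (hy | hy) hxy
  · exact hD.2 (hx.resolve_right fun hcdf => (hD.le_of_cdf_eq_one hcdf hy).not_gt hxy) hy hxy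
  · rw [D.virtualValue_of_cdf_eq_one hy]
    exact (D.virtualValue_le x).trans_lt hxy

theorem IsRegular.isUpperSet_virtualDomain (hD : D.IsRegular) : IsUpperSet D.virtualDomain := by
  rintro u v huv (hu | hu)
  · refine or_iff_not_imp_left.2 fun hv => D.cdf_eq_one_iff.2 ?_
    exact D.law_eq_zero_of_forall_not_pdf_pos fun x hx hpdf =>
      hv (hD.1.out hu hpdf ⟨huv, hx.le⟩)
  · exact .inr ((D.cdf_le_one v).antisymm (hu ▸ D.monotone_cdf huv))

variable (D)

/-- If all virtual values were below `s`, then the price `s + 1` would be sold with positive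
probability, and would raise more revenue than the virtual values above it. -/
theorem exists_le_virtualValue (s : ℝ) : ∃ p ∈ D.virtualDomain, s ≤ D.virtualValue p := by
  by_contra! hlt
  have hcdf : D.cdf (s + 1) ≠ 1 := fun h => by
    have := D.virtualValue_of_cdf_eq_one h ▸ hlt (s + 1) (.inr h)
    linarith
  have hpos : 0 < D.law.real (Ici (s + 1)) :=
    calc 0 < 1 - D.cdf (s + 1) := sub_pos.2 ((D.cdf_le_one _).lt_of_ne hcdf)
      _ = D.law.real (Ioi (s + 1)) := D.one_sub_cdf _
      _ ≤ D.law.real (Ici (s + 1)) := measureReal_mono Ioi_subset_Ici_self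
  have hle : ∫ v in Ici (s + 1), D.virtualValue v ∂D.law ≤ s * D.law.real (Ici (s + 1)) :=
    calc ∫ v in Ici (s + 1), D.virtualValue v ∂D.law ≤ ∫ _ in Ici (s + 1), s ∂D.law := by
          refine integral_mono_ae D.integrable_virtualValue.integrableOn (integrable_const s) ?_
          filter_upwards [ae_restrict_of_ae D.ae_pdf_pos] with v hv using (hlt v (.inl hv)).le
      _ = s * D.law.real (Ici (s + 1)) := by rw [setIntegral_const, smul_eq_mul, mul_comm]
  linarith [D.mul_measureReal_Ici_le (s + 1)]

theorem le_virtualInverse (s : ℝ) : s ≤ D.virtualInverse s :=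
  le_csInf (D.exists_le_virtualValue s) fun q hq => hq.2.trans (D.virtualValue_le q)

variable {D}

theorem virtualInverse_le (hv : v ∈ D.virtualDomain) (hs : s ≤ D.virtualValue v) :
    D.virtualInverse s ≤ v :=
  csInf_le ⟨0, fun _ hp => nonneg_of_mem_virtualDomain hp.1⟩ ⟨hv, hs⟩

theorem exists_lt_of_virtualInverse_lt (h : D.virtualInverse s < v) :
    ∃ p ∈ D.virtualDomain, s ≤ D.virtualValue p ∧ p < v := by
  obtain ⟨p, ⟨hp, hs⟩, hpv⟩ := exists_lt_of_csInf_lt (D.exists_le_virtualValue s) h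
  exact ⟨p, hp, hs, hpv⟩

theorem IsRegular.ae_virtualInverse_le_iff (hD : D.IsRegular) (s : ℝ) :
    ∀ᵐ v ∂D.law, (D.virtualInverse s ≤ v ↔ s ≤ D.virtualValue v) := by
  filter_upwards [D.ae_pdf_pos, compl_mem_ae_iff.2 (measure_singleton (D.virtualInverse s))]
    with v hv hne
  refine ⟨fun h => ?_, virtualInverse_le (.inl hv)⟩
  obtain ⟨p, hp, hs, hpv⟩ := exists_lt_of_virtualInverse_lt (h.lt_of_ne' hne)
  exact hs.trans (hD.strictMonoOn_virtualValue hp (.inl hv) hpv).le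

theorem IsRegular.ae_virtualValue_ne (hD : D.IsRegular) (s : ℝ) :
    ∀ᵐ v ∂D.law, D.virtualValue v ≠ s := by
  have hlevel : {v | 0 < D.pdf v ∧ D.virtualValue v = s}.Subsingleton := fun x hx y hy =>
    hD.2.injOn hx.1 hy.1 (hx.2.trans hy.2.symm)
  filter_upwards [D.ae_pdf_pos, compl_mem_ae_iff.2 (hlevel.measure_zero D.law)] with v hv hne hs
    using hne ⟨hv, hs⟩

theorem IsRegular.setIntegral_virtualValue_virtualInverse (hD : D.IsRegular) (s : ℝ) :
    ∫ v in Ici (D.virtualInverse s), D.virtualValue v ∂D.law =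
      D.virtualInverse s * D.law.real (Ici (D.virtualInverse s)) := by
  refine setIntegral_virtualValue_of_Ioi_subset fun v hv => ?_
  obtain ⟨p, hp, -, hpv⟩ := exists_lt_of_virtualInverse_lt hv
  exact hD.isUpperSet_virtualDomain hpv.le hp

theorem IsRegular.integral_max_virtualValue_sub (hD : D.IsRegular) (s : ℝ) :
    ∫ v, max (D.virtualValue v - s) 0 ∂D.law =
      (D.virtualInverse s - s) * D.law.real (Ici (D.virtualInverse s)) :=
  calc ∫ v, max (D.virtualValue v - s) 0 ∂D.law
    _ = ∫ v in {v | s ≤ D.virtualValue v}, (D.virtualValue v - s) ∂D.law := by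
      rw [max_sub_zero_eq_indicator]
      exact integral_indicator (measurableSet_le measurable_const D.measurable_virtualValue)
    _ = ∫ v in Ici (D.virtualInverse s), (D.virtualValue v - s) ∂D.law :=
      setIntegral_congr_set <| by
        filter_upwards [hD.ae_virtualInverse_le_iff s] with v hv using propext hv.symm
    _ = (D.virtualInverse s - s) * D.law.real (Ici (D.virtualInverse s)) := by
      rw [integral_sub D.integrable_virtualValue.integrableOn (integrable_const s),
        hD.setIntegral_virtualValue_virtualInverse, setIntegral_const, smul_eq_mul]
      ring

end ValueDist

namespace OracleProg

variable {Q α β : Type} (o : Q → ℝ)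

theorem run_bind (m : OracleProg Q α) (g : α → OracleProg Q β) :
    (m.bind g).run o = (g (m.run o)).run o := by
  induction m with
  | done a => rfl
  | ask _ _ ih => exact ih _

theorem queries_bind (m : OracleProg Q α) (g : α → OracleProg Q β) :
    (m.bind g).queries o = m.queries o + (g (m.run o)).queries o := by
  induction m with
  | done a => exact (Nat.zero_add _).symm
  | ask _ _ ih => simp only [bind, queries, run, ih, Nat.add_right_comm]

end OracleProg

theorem argmax_eq_some_of_le {α β : Type*} [LinearOrder β] {f g : α → β}
    {l : List α} {a : α} (hle : ∀ x, f x ≤ g x) (h : l.argmax g = some a) (ha : g a = f a) :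
    l.argmax f = some a := by
  classical
  rw [List.argmax_eq_some_iff] at h ⊢
  obtain ⟨hmem, hmax, hfirst⟩ := h
  exact ⟨hmem, fun x hx => (hle x).trans ((hmax x hx).trans_eq ha),
    fun x hx hax => hfirst x hx (ha.trans_le (hax.trans (hle x)))⟩

section Greedy

variable {n : ℕ}

/-- The item that the greedy algorithm adds to `S`: the first item outside `S` with the largest
estimate, or none if all items are in `S`. -/
noncomputable def greedyChoice (est : Finset (Fin n) → ℝ) (S : Finset (Fin n)) : Option (Fin n) :=
  ((List.finRange n).filter (· ∉ S)).argmax fun i => est (insert i S)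

variable (est : Finset (Fin n) → ℝ) {S : Finset (Fin n)} {i : Fin n}

theorem run_scanItems (S : Finset (Fin n)) (l : List (Fin n)) (best : Option (Fin n)) :
    (scanItems S l (best.map fun i => (i, est (insert i S)))).run est =
      ((l.filter (· ∉ S)).foldl (List.argAux fun b c => est (insert c S) < est (insert b S))
        best).map fun i => (i, est (insert i S)) := by
  induction l generalizing best with
  | nil => rfl
  | cons i l ih =>
    by_cases hi : i ∈ S
    · simpa [scanItems, hi] using ih best
    · rw [List.filter_cons_of_pos (by simpa using hi), List.foldl_cons, ← ih]
      rcases best with _ | j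
      · simp [scanItems, hi, OracleProg.run, List.argAux]
      · by_cases hlt : est (insert j S) < est (insert i S) <;>
          simp [scanItems, hi, OracleProg.run, List.argAux, hlt]

theorem run_greedyFrom_succ (k : ℕ) (S : Finset (Fin n)) :
    (greedyFrom (k + 1) S).run est =
      (greedyChoice est S).elim S fun i => (greedyFrom k (insert i S)).run est := by
  have hscan : (scanItems S (List.finRange n) none).run est =
      (greedyChoice est S).map fun i => (i, est (insert i S)) :=
    run_scanItems est S (List.finRange n) none
  rw [greedyFrom, OracleProg.run_bind, hscan]
  cases greedyChoice est S <;> rfl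

variable {est}

theorem greedyChoice_eq_none_iff : greedyChoice est S = none ↔ S = Finset.univ := by
  simp [greedyChoice, List.argmax_eq_none, Finset.eq_univ_iff_forall]

theorem notMem_of_greedyChoice_eq_some (h : greedyChoice est S = some i) : i ∉ S := by
  simpa using List.argmax_mem h

theorem le_of_greedyChoice_eq_some (h : greedyChoice est S = some i) {j : Fin n} (hj : j ∉ S) :
    est (insert j S) ≤ est (insert i S) :=
  List.le_of_mem_argmax (f := fun i => est (insert i S)) (by simpa using hj) h

variable (est)

theorem queries_scanItems_le (S : Finset (Fin n)) (l : List (Fin n))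
    (best : Option (Fin n × ℝ)) : (scanItems S l best).queries est ≤ l.length := by
  induction l generalizing best with
  | nil => exact le_rfl
  | cons i l ih =>
    rw [scanItems, List.length_cons]
    split_ifs
    · exact (ih best).trans (Nat.le_succ _)
    · refine Nat.succ_le_succ ?_
      rcases best with _ | ⟨j, y⟩
      · exact ih _
      · dsimp only
        split_ifs <;> exact ih _

theorem queries_greedyFrom_le (k : ℕ) (S : Finset (Fin n)) :
    (greedyFrom k S).queries est ≤ k * n := by
  induction k generalizing S with
  | zero => exact Nat.zero_le _
  | succ k ih =>
    rw [greedyFrom, OracleProg.queries_bind, Nat.succ_mul, Nat.add_comm]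
    refine Nat.add_le_add ?_ ((queries_scanItems_le est S _ none).trans_eq List.length_finRange)
    rcases (scanItems S (List.finRange n) none).run est with _ | ⟨i, _⟩
    · exact Nat.zero_le _
    · exact ih _

theorem subset_run_greedyFrom (k : ℕ) (S : Finset (Fin n)) : S ⊆ (greedyFrom k S).run est := by
  induction k generalizing S with
  | zero => exact Finset.Subset.refl S
  | succ k ih =>
    rw [run_greedyFrom_succ]
    rcases greedyChoice est S with _ | i
    · exact Finset.Subset.refl S
    · exact (Finset.subset_insert i S).trans (ih _)

theorem card_run_greedyFrom (k : ℕ) (S : Finset (Fin n)) :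
    ((greedyFrom k S).run est).card = min (S.card + k) n := by
  induction k generalizing S with
  | zero => simpa [greedyFrom, OracleProg.run] using S.card_le_univ
  | succ k ih =>
    rw [run_greedyFrom_succ]
    rcases hchoice : greedyChoice est S with _ | i
    · simp [greedyChoice_eq_none_iff.1 hchoice]
    · rw [Option.elim_some, ih,
        Finset.card_insert_of_notMem (notMem_of_greedyChoice_eq_some hchoice), Nat.add_right_comm,
        Nat.add_assoc]

variable {est}

theorem greedyChoice_eq_some_of_le {est' : Finset (Fin n) → ℝ} {j : Fin n}
    (heq : ∀ S, i ∉ S → est' S = est S) (hle : ∀ S, est S ≤ est' S) (hi : i ∉ S) (hji : j ≠ i)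
    (hj : greedyChoice est' S = some j) : greedyChoice est S = some j :=
  argmax_eq_some_of_le (fun _ => hle _) hj (heq _ (by simp [hi, hji.symm]))

theorem mem_run_greedyFrom_of_le {est' : Finset (Fin n) → ℝ}
    (heq : ∀ S, i ∉ S → est' S = est S) (hle : ∀ S, est S ≤ est' S) (k : ℕ) (S : Finset (Fin n))
    (h : i ∈ (greedyFrom k S).run est) : i ∈ (greedyFrom k S).run est' := by
  induction k generalizing S with
  | zero => exact h
  | succ k ih =>
    by_cases hi : i ∈ S
    · exact subset_run_greedyFrom est' _ S hi
    rw [run_greedyFrom_succ] at h ⊢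
    rcases hchoice : greedyChoice est' S with _ | j
    · exact absurd (greedyChoice_eq_none_iff.1 hchoice ▸ Finset.mem_univ i) hi
    · by_cases hji : j = i
      · exact subset_run_greedyFrom est' k _ (hji ▸ Finset.mem_insert_self j S)
      · rw [greedyChoice_eq_some_of_le heq hle hi hji hchoice] at h
        exact ih _ h

theorem sub_run_greedyFrom_le {g : Finset (Fin n) → ℝ} (hsub : IsSubmodular g) (hmono : Monotone g)
    {K : ℕ} (hK : 0 < K) {ε : ℝ} (hest : ∀ S : Finset (Fin n), S.card ≤ K → |est S - g S| ≤ ε)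
    {T : Finset (Fin n)} (hT : T.card ≤ K) {k : ℕ} {S : Finset (Fin n)} (hS : S.card + k ≤ K) :
    g T - g ((greedyFrom k S).run est) ≤ (1 - 1 / (K : ℝ)) ^ k * (g T - g S) + 2 * k * ε := by
  have hε : 0 ≤ ε := (abs_nonneg _).trans (hest ∅ (Nat.zero_le _))
  have hq0 : 0 ≤ 1 - 1 / (K : ℝ) := sub_nonneg.2 (div_le_one_of_le₀ (mod_cast hK) K.cast_nonneg)
  have hq1 : 1 - 1 / (K : ℝ) ≤ 1 := sub_le_self _ (by positivity)
  induction k generalizing S with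
  | zero => simp [greedyFrom, OracleProg.run]
  | succ k ih =>
    rw [run_greedyFrom_succ]
    rcases hchoice : greedyChoice est S with _ | i
    · obtain rfl := greedyChoice_eq_none_iff.1 hchoice
      have hgap : g T - g Finset.univ ≤ 0 := sub_nonpos.2 (hmono (Finset.subset_univ T))
      have hshrink : g T - g Finset.univ ≤ (1 - 1 / (K : ℝ)) ^ (k + 1) * (g T - g Finset.univ) := by
        nlinarith [pow_le_one₀ (n := k + 1) hq0 hq1]
      exact hshrink.trans (le_add_of_nonneg_right (by positivity))
    · have hiS := notMem_of_greedyChoice_eq_some hchoice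
      have hcard : ∀ j, (insert j S).card ≤ K := fun j => (Finset.card_insert_le j S).trans (by lia)
      have hbest : ∀ j ∉ S, g (insert j S) ≤ g (insert i S) + 2 * ε := fun j hj => by
        linarith [le_of_greedyChoice_eq_some hchoice hj, (abs_le.1 (hest _ (hcard j))).1,
          (abs_le.1 (hest _ (hcard i))).2]
      calc g T - g ((greedyFrom k (insert i S)).run est)
        _ ≤ (1 - 1 / (K : ℝ)) ^ k * (g T - g (insert i S)) + 2 * k * ε :=
          ih (by rw [Finset.card_insert_of_notMem hiS]; lia)
        _ ≤ (1 - 1 / (K : ℝ)) ^ k * ((1 - 1 / (K : ℝ)) * (g T - g S)) + 2 * ε + 2 * k * ε := by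
          have hround := hsub.sub_insert_le hmono hK hT (by positivity : 0 ≤ 2 * ε) hbest
          nlinarith [pow_le_one₀ (n := k) hq0 hq1, pow_nonneg hq0 k]
        _ = (1 - 1 / (K : ℝ)) ^ (k + 1) * (g T - g S) + 2 * (k + 1 : ℕ) * ε := by
          push_cast
          ring

theorem sub_run_greedy_le {g : Finset (Fin n) → ℝ} (hsub : IsSubmodular g) (hmono : Monotone g)
    {k : ℕ} {ε : ℝ} (hest : ∀ S : Finset (Fin n), S.card ≤ k → |est S - g S| ≤ ε)
    {T : Finset (Fin n)} (hT : T.card ≤ k) :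
    g T - g ((greedy n k).run est) ≤ Real.exp (-1) * (g T - g ∅) + 2 * k * ε := by
  rcases k.eq_zero_or_pos with rfl | hk
  · obtain rfl : T = ∅ := Finset.card_eq_zero.1 (Nat.le_zero.1 hT)
    simp [greedy, greedyFrom, OracleProg.run]
  · calc g T - g ((greedy n k).run est)
      _ ≤ (1 - 1 / (k : ℝ)) ^ k * (g T - g ∅) + 2 * k * ε :=
        sub_run_greedyFrom_le hsub hmono hk hest hT (by simp)
      _ ≤ Real.exp (-1) * (g T - g ∅) + 2 * k * ε := by
        have hgap : 0 ≤ g T - g ∅ := sub_nonneg.2 (hmono (Finset.empty_subset T))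
        gcongr
        exact Real.one_sub_div_pow_le_exp_neg (by exact_mod_cast hk)

end Greedy

section Values

variable {n : ℕ} (D : Fin n → ValueDist) (κ : Fin n → ℝ) {S T : Finset (Fin n)} {i : Fin n}

instance isProbabilityMeasure_valueLaw : IsProbabilityMeasure (valueLaw D) := by
  unfold valueLaw; infer_instance

variable {D} in
theorem ae_valueLaw_of_forall_ae_law {P : Fin n → ℝ → Prop}
    (h : ∀ i, ∀ᵐ x ∂(D i).law, P i x) : ∀ᵐ v ∂valueLaw D, ∀ i, P i (v i) :=
  ae_all_iff.2 fun i => Measure.tendsto_eval_ae_ae.eventually (h i)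

theorem ae_injective_sub (p : Fin n → ℝ) :
    ∀ᵐ v ∂valueLaw D, Function.Injective fun i => v i - p i := by
  have hne : ∀ᵐ v ∂valueLaw D, ∀ i j, i ≠ j → v i ≠ v j - p j + p i := by
    simp only [ae_all_iff]
    exact fun i j hij => ae_pi_eval_ne (fun i => (D i).law) i (by fun_prop) fun v x => by
      rw [Function.update_of_ne hij.symm]
  filter_upwards [hne] with v hv i j hij
  exact of_not_not fun h => hv i j h (sub_eq_iff_eq_add.1 hij)

theorem measurableSet_buysItem (S : Finset (Fin n)) (p : Fin n → ℝ) (i : Fin n) :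
    MeasurableSet (buysItem S p i) := by
  unfold buysItem
  measurability

theorem maxVirtual_nonneg (S : Finset (Fin n)) (v : Fin n → ℝ) : 0 ≤ maxVirtual D κ S v :=
  (Finset.le_fold_max _).2 (.inl le_rfl)

theorem le_maxVirtual (hi : i ∈ S) (v : Fin n → ℝ) :
    (D i).virtualValue (v i) - κ i ≤ maxVirtual D κ S v :=
  (Finset.le_fold_max _).2 (.inr ⟨i, hi, le_rfl⟩)

theorem integrable_virtualValue_eval (i : Fin n) :
    Integrable (fun v : Fin n → ℝ => (D i).virtualValue (v i)) (valueLaw D) :=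
  integrable_comp_eval (D i).integrable_virtualValue

theorem integrable_virtualValue_eval_sub (i : Fin n) :
    Integrable (fun v : Fin n → ℝ => (D i).virtualValue (v i) - κ i) (valueLaw D) :=
  (integrable_virtualValue_eval D i).sub (integrable_const _)

theorem integrable_maxVirtual (S : Finset (Fin n)) :
    Integrable (maxVirtual D κ S) (valueLaw D) := by
  induction S using Finset.induction_on with
  | empty => exact integrable_const 0
  | insert i S hi ih =>
    refine ((integrable_virtualValue_eval_sub D κ i).sup ih).congr (.of_forall fun v => ?_)
    exact (Finset.fold_insert hi).symm

theorem expMaxVirtual_nonneg (S : Finset (Fin n)) : 0 ≤ expMaxVirtual D κ S :=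
  integral_nonneg (maxVirtual_nonneg D κ S)

theorem expMaxVirtual_empty : expMaxVirtual D κ ∅ = 0 := by
  simp only [expMaxVirtual, maxVirtual, Finset.fold_empty, integral_zero]

theorem monotone_expMaxVirtual : Monotone (expMaxVirtual D κ) := fun S T h =>
  integral_mono (integrable_maxVirtual D κ S) (integrable_maxVirtual D κ T) fun _ =>
    fold_max_mono h _ _

theorem isSubmodular_expMaxVirtual : IsSubmodular (expMaxVirtual D κ) :=
  isSubmodular_integral (integrable_maxVirtual D κ) fun _ => isSubmodular_fold_max _ _

theorem antitone_expMaxVirtual (S : Finset (Fin n)) :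
    Antitone fun κ => expMaxVirtual D κ S := fun κ' κ hκ =>
  integral_mono (integrable_maxVirtual D κ S) (integrable_maxVirtual D κ' S) fun v =>
    (Finset.fold_max_le _).2 ⟨maxVirtual_nonneg D κ' S v, fun i hi =>
      (sub_le_sub_left (hκ i) _).trans (le_maxVirtual D κ' hi v)⟩

variable {κ} in
theorem expMaxVirtual_congr {κ' : Fin n → ℝ} (h : ∀ i ∈ S, κ' i = κ i) :
    expMaxVirtual D κ' S = expMaxVirtual D κ S :=
  congrArg (integral (valueLaw D)) <| funext fun _ => Finset.fold_congr fun i hi => by rw [h i hi]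

theorem exists_update_mem_buysItem_iff (hi : i ∈ T) (q v : Fin n → ℝ) :
    ∃ t, q i ≤ t ∧ ∀ x, Function.update v i x ∈ buysItem T q i ↔ t ≤ x := by
  refine ⟨q i + (T.erase i).fold max 0 fun j => v j - q j,
    le_add_of_nonneg_right ((Finset.le_fold_max _).2 (.inl le_rfl)), fun x => ?_⟩
  rw [← le_sub_iff_add_le', Finset.fold_max_le]
  simp only [buysItem, mem_ofPred_eq, Function.update_self, hi, true_and]
  refine and_congr_right fun _ => ⟨fun h j hj => ?_, fun h j hj => ?_⟩
  · simpa [Finset.ne_of_mem_erase hj] using h j (Finset.mem_of_mem_erase hj)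
  · rcases eq_or_ne j i with rfl | hji
    · rw [Function.update_self]
    · simpa [hji] using h j (Finset.mem_erase.2 ⟨hji, hj⟩)

theorem mul_measureReal_buysItem_le (hi : i ∈ T) (q : Fin n → ℝ) :
    q i * (valueLaw D).real (buysItem T q i) ≤
      ∫ v in buysItem T q i, (D i).virtualValue (v i) ∂valueLaw D := by
  have hB := measurableSet_buysItem T q i
  suffices h : 0 ≤ ∫ v in buysItem T q i, ((D i).virtualValue (v i) - q i) ∂valueLaw D by
    rw [integral_sub (integrable_virtualValue_eval D i).integrableOn (integrable_const _),
      setIntegral_const, smul_eq_mul] at h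
    linarith
  rw [← integral_indicator hB, valueLaw, integral_pi_eq_integral_integral_update _ i
    ((integrable_virtualValue_eval_sub D q i).indicator hB)]
  refine integral_nonneg fun v => ?_
  obtain ⟨t, ht, hslice⟩ := exists_update_mem_buysItem_iff hi q v
  have hindicator : (fun x => (buysItem T q i).indicator
      (fun v => (D i).virtualValue (v i) - q i) (Function.update v i x)) =
      (Ici t).indicator fun x => (D i).virtualValue x - q i := by
    ext x
    simp only [indicator, hslice, mem_Ici, Function.update_self]
  calc 0 ≤ ∫ x in Ici t, (D i).virtualValue x ∂(D i).law - q i * (D i).law.real (Ici t) :=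
        sub_nonneg.2 <| (mul_le_mul_of_nonneg_right ht measureReal_nonneg).trans
          ((D i).mul_measureReal_Ici_le t)
    _ = ∫ x, (Ici t).indicator (fun x => (D i).virtualValue x - q i) x ∂(D i).law := by
      rw [integral_indicator measurableSet_Ici, integral_sub
        (D i).integrable_virtualValue.integrableOn (integrable_const _), setIntegral_const,
        smul_eq_mul, mul_comm]
    _ = _ := by rw [← hindicator]

theorem sum_indicator_buysItem_le_maxVirtual {q v : Fin n → ℝ}
    (hv : Function.Injective fun i => v i - q i) :
    ∑ i ∈ T, (buysItem T q i).indicator (fun v => (D i).virtualValue (v i) - κ i) v ≤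
      maxVirtual D κ T v := by
  by_cases h : ∃ i ∈ T, v ∈ buysItem T q i
  · obtain ⟨i, hi, hvi⟩ := h
    have hother : ∀ j ∈ T, j ≠ i → v ∉ buysItem T q j := fun j hj hji hvj =>
      hji (hv ((hvi.2.2 j hj).antisymm (hvj.2.2 i hi)))
    rw [Finset.sum_eq_single_of_mem i hi fun j hj hji => indicator_of_notMem (hother j hj hji) _,
      indicator_of_mem hvi]
    exact le_maxVirtual D κ hi v
  · push Not at h
    rw [Finset.sum_eq_zero fun i hi => indicator_of_notMem (h i hi) _]
    exact maxVirtual_nonneg D κ T v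

theorem revenue_le_expMaxVirtual (T : Finset (Fin n)) (q : Fin n → ℝ) :
    revenue D κ T q ≤ expMaxVirtual D κ T := by
  have hB := measurableSet_buysItem T q
  have hint := fun i => (integrable_virtualValue_eval_sub D κ i).indicator (hB i)
  calc revenue D κ T q
    _ ≤ ∑ i ∈ T, ∫ v in buysItem T q i, ((D i).virtualValue (v i) - κ i) ∂valueLaw D := by
      refine Finset.sum_le_sum fun i hi => ?_
      rw [integral_sub (integrable_virtualValue_eval D i).integrableOn (integrable_const _),
        setIntegral_const, smul_eq_mul]
      linarith [mul_measureReal_buysItem_le D hi q]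
    _ = ∫ v, ∑ i ∈ T, (buysItem T q i).indicator (fun v => (D i).virtualValue (v i) - κ i) v
          ∂valueLaw D := by
      rw [integral_finsetSum _ fun i _ => hint i]
      exact Finset.sum_congr rfl fun i _ => (integral_indicator (hB i)).symm
    _ ≤ expMaxVirtual D κ T := by
      refine integral_mono_ae (integrable_finsetSum _ fun i _ => hint i)
        (integrable_maxVirtual D κ T) ?_
      filter_upwards [ae_injective_sub D q] with v hv
      exact sum_indicator_buysItem_le_maxVirtual D κ hv

theorem exists_mem_buysItem {p v : Fin n → ℝ} (h : ∃ i ∈ S, p i ≤ v i) :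
    ∃ i ∈ S, v ∈ buysItem S p i := by
  obtain ⟨i, hi, hpi⟩ := h
  obtain ⟨j, hj, hmax⟩ := S.exists_max_image (fun j => v j - p j) ⟨i, hi⟩
  exact ⟨j, hj, hj, (sub_nonneg.2 hpi).trans (hmax i hi), hmax⟩

theorem measure_Ici_mul_measure_lt_le (hi : i ∈ S) (p : Fin n → ℝ) :
    (D i).law (Ici (p i)) * valueLaw D {v | ∀ j ∈ S.erase i, v j < p j} ≤
      valueLaw D (buysItem S p i) := by
  have hmeas : MeasurableSet {v : Fin n → ℝ | ∀ j ∈ S.erase i, v j < p j} := by measurability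
  have hupdate : ∀ (v : Fin n → ℝ) (x : ℝ),
      Function.update v i x ∈ {v : Fin n → ℝ | ∀ j ∈ S.erase i, v j < p j} ↔
        v ∈ {v : Fin n → ℝ | ∀ j ∈ S.erase i, v j < p j} := fun v x =>
    forall₂_congr fun j hj => by rw [Function.update_of_ne (Finset.ne_of_mem_erase hj)]
  rw [valueLaw, ← measure_pi_eval_preimage_inter (fun i => (D i).law) i measurableSet_Ici hmeas
    hupdate]
  refine measure_mono fun v ⟨(hvi : p i ≤ v i), hv⟩ => ⟨hi, sub_nonneg.2 hvi, fun j hj => ?_⟩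
  rcases eq_or_ne j i with rfl | hji
  · exact le_rfl
  · linarith [hv j (Finset.mem_erase.2 ⟨hji, hj⟩)]

variable {D} (hD : ∀ i, (D i).IsRegular)
include hD

theorem ae_virtualReservePrices_le_iff (r : ℝ) :
    ∀ᵐ v ∂valueLaw D, ∀ i, virtualReservePrices D κ r i ≤ v i ↔
      r ≤ (D i).virtualValue (v i) - κ i := by
  simpa only [le_sub_iff_add_le, virtualReservePrices] using
    ae_valueLaw_of_forall_ae_law fun i => (hD i).ae_virtualInverse_le_iff (r + κ i)

theorem ae_lt_virtualReservePrices_of_maxVirtual_le (S : Finset (Fin n)) (r : ℝ) :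
    ∀ᵐ v ∂valueLaw D, maxVirtual D κ S v ≤ r → ∀ i ∈ S, v i < virtualReservePrices D κ r i := by
  filter_upwards [ae_virtualReservePrices_le_iff κ hD r,
    ae_valueLaw_of_forall_ae_law fun i => (hD i).ae_virtualValue_ne (r + κ i)]
    with v hle hne hZ i hi
  refine lt_of_not_ge fun hpi => hne i (sub_eq_iff_eq_add.1 ?_)
  exact ((le_maxVirtual D κ hi v).trans hZ).antisymm ((hle i).1 hpi)

theorem measureReal_maxVirtual_le_mul_le (hi : i ∈ S) (r : ℝ) :
    (valueLaw D).real {v | maxVirtual D κ S v ≤ r} *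
        (D i).law.real (Ici (virtualReservePrices D κ r i)) ≤
      (valueLaw D).real (buysItem S (virtualReservePrices D κ r) i) := by
  rw [measureReal_def, measureReal_def, ← ENNReal.toReal_mul, mul_comm]
  refine ENNReal.toReal_mono (measure_ne_top _ _)
    (le_trans ?_ (measure_Ici_mul_measure_lt_le D hi _))
  gcongr 1
  refine measure_mono_ae ?_
  filter_upwards [ae_lt_virtualReservePrices_of_maxVirtual_le κ hD S r] with v hv hZ j hj
  exact hv hZ j (Finset.mem_of_mem_erase hj)

theorem measureReal_le_maxVirtual_le_sum (S : Finset (Fin n)) {r : ℝ} (hr : 0 < r) :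
    (valueLaw D).real {v | r ≤ maxVirtual D κ S v} ≤
      ∑ i ∈ S, (valueLaw D).real (buysItem S (virtualReservePrices D κ r) i) := by
  refine le_trans (ENNReal.toReal_mono (measure_ne_top _ _) (measure_mono_ae ?_))
    (measureReal_biUnion_finset_le S (buysItem S (virtualReservePrices D κ r)))
  filter_upwards [ae_virtualReservePrices_le_iff κ hD r] with v hv (hZ : r ≤ maxVirtual D κ S v)
  obtain ⟨i, hi, hri⟩ := ((Finset.le_fold_max _).1 hZ).resolve_left hr.not_ge
  obtain ⟨j, hj, hvj⟩ := exists_mem_buysItem ⟨i, hi, (hv i).2 hri⟩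
  exact mem_biUnion hj hvj

theorem integral_max_virtualValue_eval_sub (i : Fin n) (r : ℝ) :
    ∫ v, max ((D i).virtualValue (v i) - κ i - r) 0 ∂valueLaw D =
      (virtualReservePrices D κ r i - κ i - r) *
        (D i).law.real (Ici (virtualReservePrices D κ r i)) := by
  have hmeas : Measurable fun x => max ((D i).virtualValue x - (r + κ i)) 0 :=
    ((D i).measurable_virtualValue.sub_const _).max measurable_const
  simp only [sub_sub, add_comm (κ i)]
  rw [valueLaw, integral_comp_eval (μ := fun i => (D i).law) (i := i) hmeas.aestronglyMeasurable]
  exact (hD i).integral_max_virtualValue_sub (r + κ i)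

theorem expMaxVirtual_le_add_sum (S : Finset (Fin n)) {r : ℝ} (hr : 0 ≤ r) :
    expMaxVirtual D κ S ≤ r + ∑ i ∈ S, (virtualReservePrices D κ r i - κ i - r) *
      (D i).law.real (Ici (virtualReservePrices D κ r i)) := by
  have hint : ∀ i ∈ S, Integrable
      (fun v : Fin n → ℝ => max ((D i).virtualValue (v i) - κ i - r) 0) (valueLaw D) := fun i _ =>
    ((integrable_virtualValue_eval_sub D κ i).sub (integrable_const r)).pos_part
  calc expMaxVirtual D κ S
    _ ≤ ∫ v, (r + ∑ i ∈ S, max ((D i).virtualValue (v i) - κ i - r) 0) ∂valueLaw D :=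
      integral_mono (integrable_maxVirtual D κ S)
        ((integrable_const r).add (integrable_finsetSum _ hint)) fun _ => fold_max_le_add_sum hr _ _
    _ = _ := by
      rw [integral_add (integrable_const r) (integrable_finsetSum _ hint),
        integral_finsetSum _ hint, integral_const, probReal_univ, one_smul]
      simp only [integral_max_virtualValue_eval_sub κ hD]

/-- Every sale earns `r`, and there is one when `r ≤ Z`. In addition, item `i` earns its margin
above `r` whenever `v i` is at least its price and all other items are priced out; the latter is
independent of `v i` and happens when `Z ≤ r`. The sum of these margins, each weighted with the
probability that `v i` is at least the price, bounds the excess of `E[Z]` over `r`. -/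
theorem min_measureReal_mul_expMaxVirtual_le_revenue (S : Finset (Fin n)) {r : ℝ} (hr : 0 ≤ r) :
    min ((valueLaw D).real {v | maxVirtual D κ S v ≤ r})
        ((valueLaw D).real {v | r ≤ maxVirtual D κ S v}) * expMaxVirtual D κ S ≤
      revenue D κ S (virtualReservePrices D κ r) := by
  set c := min ((valueLaw D).real {v | maxVirtual D κ S v ≤ r})
    ((valueLaw D).real {v | r ≤ maxVirtual D κ S v})
  set p := virtualReservePrices D κ r
  have hc : 0 ≤ c := le_min measureReal_nonneg measureReal_nonneg
  have hreserve : c * r ≤ (∑ i ∈ S, (valueLaw D).real (buysItem S p i)) * r := by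
    rcases hr.eq_or_lt with rfl | hr
    · simp only [mul_zero, le_refl]
    · gcongr
      exact (min_le_right _ _).trans (measureReal_le_maxVirtual_le_sum κ hD S hr)
  have hmargin : ∀ i, 0 ≤ p i - κ i - r := fun i => by
    have hp : r + κ i ≤ p i := (D i).le_virtualInverse (r + κ i)
    linarith
  calc c * expMaxVirtual D κ S
    _ ≤ c * (r + ∑ i ∈ S, (p i - κ i - r) * (D i).law.real (Ici (p i))) := by
      gcongr
      exact expMaxVirtual_le_add_sum κ hD S hr
    _ = c * r + ∑ i ∈ S, (p i - κ i - r) * (c * (D i).law.real (Ici (p i))) := by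
      simp only [mul_add, Finset.mul_sum, mul_left_comm c]
    _ ≤ (∑ i ∈ S, (valueLaw D).real (buysItem S p i)) * r +
          ∑ i ∈ S, (p i - κ i - r) * (valueLaw D).real (buysItem S p i) := by
      gcongr with i hi
      · exact hmargin i
      · refine le_trans ?_ (measureReal_maxVirtual_le_mul_le κ hD hi r)
        gcongr
        exact min_le_left _ _
    _ = revenue D κ S p := by
      rw [Finset.sum_mul, ← Finset.sum_add_distrib]
      exact Finset.sum_congr rfl fun i _ => by ring

omit hD in
theorem nonneg_of_isMedian_maxVirtual {r : ℝ} (hr : IsMedian (valueLaw D) (maxVirtual D κ S) r) :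
    0 ≤ r := by
  have hpos : valueLaw D {v | maxVirtual D κ S v ≤ r} ≠ 0 :=
    ((by simp : (0 : ENNReal) < 1 / 2).trans_le hr.1).ne'
  obtain ⟨v, hv⟩ := nonempty_of_measure_ne_zero hpos
  exact (maxVirtual_nonneg D κ S v).trans hv

theorem half_mul_expMaxVirtual_le_revenue {r : ℝ}
    (hr : IsMedian (valueLaw D) (maxVirtual D κ S) r) :
    1 / 2 * expMaxVirtual D κ S ≤ revenue D κ S (virtualReservePrices D κ r) := by
  have hhalf : ∀ A, 1 / 2 ≤ valueLaw D A → 1 / 2 ≤ (valueLaw D).real A := fun A hA => by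
    simpa [measureReal_def] using ENNReal.toReal_mono (measure_ne_top _ _) hA
  refine le_trans ?_ (min_measureReal_mul_expMaxVirtual_le_revenue κ hD S
    (nonneg_of_isMedian_maxVirtual κ hr))
  gcongr
  · exact expMaxVirtual_nonneg D κ S
  · exact le_min (hhalf _ hr.1) (hhalf _ hr.2)

end Values

theorem revenue_run_greedy_ge {n k : ℕ} {D : Fin n → ValueDist} (hD : ∀ i, (D i).IsRegular)
    {κ : Fin n → ℝ} {est : Finset (Fin n) → ℝ} {ε : ℝ}
    (hest : ∀ S : Finset (Fin n), S.card ≤ k → |est S - expMaxVirtual D κ S| ≤ ε) {r : ℝ}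
    (hr : IsMedian (valueLaw D) (maxVirtual D κ ((greedy n k).run est)) r)
    {T : Finset (Fin n)} (hT : T.card ≤ k) (q : Fin n → ℝ) :
    (Real.exp 1 - 1) / (2 * Real.exp 1) * revenue D κ T q - k * ε ≤
      revenue D κ ((greedy n k).run est) (virtualReservePrices D κ r) := by
  have hconst : (Real.exp 1 - 1) / (2 * Real.exp 1) = 1 / 2 * (1 - Real.exp (-1)) := by
    rw [Real.exp_neg]
    field_simp
  have hfactor : 0 ≤ 1 / 2 * (1 - Real.exp (-1)) :=
    mul_nonneg one_half_pos.le (sub_nonneg.2 (Real.exp_le_one_iff.2 (by norm_num)))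
  have hgreedy := sub_run_greedy_le (isSubmodular_expMaxVirtual D κ) (monotone_expMaxVirtual D κ)
    hest hT
  rw [expMaxVirtual_empty, sub_zero] at hgreedy
  calc (Real.exp 1 - 1) / (2 * Real.exp 1) * revenue D κ T q - k * ε
    _ ≤ 1 / 2 * (1 - Real.exp (-1)) * expMaxVirtual D κ T - k * ε := by
      rw [hconst]
      gcongr
      exact revenue_le_expMaxVirtual D κ T q
    _ ≤ 1 / 2 * expMaxVirtual D κ ((greedy n k).run est) := by linarith
    _ ≤ revenue D κ ((greedy n k).run est) (virtualReservePrices D κ r) :=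
      half_mul_expMaxVirtual_le_revenue κ hD hr

theorem mem_run_greedy_expMaxVirtual_of_le {n k : ℕ} (D : Fin n → ValueDist) {κ κ' : Fin n → ℝ}
    {i : Fin n} (hi : κ' i ≤ κ i) (hne : ∀ j, j ≠ i → κ' j = κ j)
    (h : i ∈ (greedy n k).run (expMaxVirtual D κ)) :
    i ∈ (greedy n k).run (expMaxVirtual D κ') := by
  have hκ : κ' ≤ κ := fun j => by
    rcases eq_or_ne j i with rfl | hji
    exacts [hi, (hne j hji).le]
  refine mem_run_greedyFrom_of_le (fun S hS => ?_) (fun S => antitone_expMaxVirtual D S hκ) k ∅ h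
  exact expMaxVirtual_congr D fun j hj => hne j fun hji => hS (hji ▸ hj)

theorem mainTheorem7 {n : ℕ} (k : ℕ) (D : Fin n → ValueDist) (hD : ∀ i, (D i).IsRegular) :
    (∀ (κ : Fin n → ℝ) (est : Finset (Fin n) → ℝ) (ε : ℝ),
      (∀ S : Finset (Fin n), S.card ≤ k → |est S - expMaxVirtual D κ S| ≤ ε) →
        ((greedy n k).run est).card = min k n ∧
        (greedy n k).queries est ≤ k * n ∧
        (∃ r : ℝ, IsMedian (valueLaw D) (maxVirtual D κ ((greedy n k).run est)) r) ∧
        ∀ r : ℝ, IsMedian (valueLaw D) (maxVirtual D κ ((greedy n k).run est)) r →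
          ∀ (T : Finset (Fin n)) (q : Fin n → ℝ), T.card ≤ k →
            (Real.exp 1 - 1) / (2 * Real.exp 1) * revenue D κ T q - k * ε
              ≤ revenue D κ ((greedy n k).run est) (virtualReservePrices D κ r)) ∧
    (∀ (κ κ' : Fin n → ℝ) (i : Fin n), κ' i ≤ κ i → (∀ j, j ≠ i → κ' j = κ j) →
      i ∈ (greedy n k).run (expMaxVirtual D κ) →
        i ∈ (greedy n k).run (expMaxVirtual D κ')) := by
  refine ⟨fun κ est ε hest => ⟨?_, queries_greedyFrom_le est k ∅, ?_, fun r hr T q hT => ?_⟩,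
    fun κ κ' i hi hne => mem_run_greedy_expMaxVirtual_of_le D hi hne⟩
  · rw [greedy, card_run_greedyFrom, Finset.card_empty, Nat.zero_add]
  · exact exists_isMedian _ (integrable_maxVirtual D κ _).aemeasurable
  · exact revenue_run_greedy_ge hD hest hr hT q
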